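/- Let $H$ be a random $2\times 2$ complex matrix with independent entries $H_{ij}\sim\mathcal{CN}(0,\phi_{ij})$, $i,j\in\{1,2\}$ (circularly symmetric complex Gaussian: the real and imaginary parts are independent real Gaussians with mean $0$ and variance $\phi_{ij}/2$), where all $\phi_{ij}>0$ and $\phi_{i1}\neq\phi_{i2}$ for at least one $i$. Put $$K=\prod_{1\le i,j\le 2}\frac1{\phi_{ij}},\qquad s_i=\frac1{\phi_{i1}}+\frac1{\phi_{i2}},\qquad \epsilon_i=\frac1{\phi_{i1}}-\frac1{\phi_{i2}},$$ and for a Hermitian matrix $W=\begin{pmatrix} w_1 & w_3\\ \overline{w_3} & w_2\end{pmatrix}$ put $D(W)=(w_1\epsilon_1-w_2\epsilon_2)^2+4|w_3|^2\epsilon_1\epsilon_2$. Then $D(W)\ge 0$ for every positive semidefinite $W$, and the random matrix $W=HH^\dagger$ has a probability density with respect to Lebesgue measure $dw_1\,dw_2\,d\operatorname{Re}(w_3)\,d\operatorname{Im}(w_3)$ on the Hermitian $2\times2$ matrices; this density is $$p(W)=\frac{K}{\pi}\,e^{-\frac12(w_1s_1+w_2s_2)}\;\frac{\sinh\left(\frac12\sqrt{D(W)}\right)}{\frac12\sqrt{D(W)}}$$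 for positive semidefinite $W$, and $0$ for all other Hermitian $W$. (Where $D(W)=0$, the quotient is read as its limit $1$.) -/

import Mathlib

open MeasureTheory ProbabilityTheory
open scoped Matrix ComplexOrder

noncomputable section

namespace GramGaussian

/-- The product (= Borel) σ-algebra on complex `2 × 2` matrices. -/
instance : MeasurableSpace (Matrix (Fin 2) (Fin 2) ℂ) :=
  inferInstanceAs (MeasurableSpace (Fin 2 → Fin 2 → ℂ))

/-- The circularly symmetric complex Gaussian law `CN(0, v)`: real and imaginary parts are
independent centred real Gaussians of variance `v / 2` each, so that `E|z|² = v`. -/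
def complexGaussian (v : ℝ) : Measure ℂ :=
  ((gaussianReal 0 (v / 2).toNNReal).prod (gaussianReal 0 (v / 2).toNNReal)).map
    Complex.measurableEquivRealProd.symm

/-- The Hermitian matrix with diagonal `w₁, w₂` and upper right entry `w₃`. -/
def hermitianOf (x : ℝ × ℝ × ℂ) : Matrix (Fin 2) (Fin 2) ℂ :=
  !![(x.1 : ℂ), x.2.2; star x.2.2, (x.2.1 : ℂ)]

/-- Lebesgue measure `dw₁ dw₂ dRe(w₃) dIm(w₃)` on the Hermitian `2 × 2` matrices, seen as a
measure on all complex `2 × 2` matrices. -/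
def hermitianLebesgue : Measure (Matrix (Fin 2) (Fin 2) ℂ) :=
  Measure.map hermitianOf (volume : Measure (ℝ × ℝ × ℂ))

/-- `sinh x / x`, continuously extended by `1` at `x = 0`. -/
def sinhc (x : ℝ) : ℝ := if x = 0 then 1 else Real.sinh x / x

/-- `K = ∏ 1 / φ i j`. -/
def K (φ : Fin 2 → Fin 2 → ℝ) : ℝ := ∏ i, ∏ j, 1 / φ i j

/-- `s i = 1 / φ i 1 + 1 / φ i 2`. -/
def s (φ : Fin 2 → Fin 2 → ℝ) (i : Fin 2) : ℝ := 1 / φ i 0 + 1 / φ i 1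

/-- `ε i = 1 / φ i 1 - 1 / φ i 2`. -/
def ε (φ : Fin 2 → Fin 2 → ℝ) (i : Fin 2) : ℝ := 1 / φ i 0 - 1 / φ i 1

/-- `D = (w₁ ε₁ - w₂ ε₂)² + 4 |w₃|² ε₁ ε₂`, with `w₁, w₂` the (real) diagonal entries of `W` and
`w₃` its upper right entry. -/
def D (φ : Fin 2 → Fin 2 → ℝ) (W : Matrix (Fin 2) (Fin 2) ℂ) : ℝ :=
  ((W 0 0).re * ε φ 0 - (W 1 1).re * ε φ 1) ^ 2 + 4 * ‖W 0 1‖ ^ 2 * ε φ 0 * ε φ 1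

/-- The density of the Gram matrix. -/
def gramDensity (φ : Fin 2 → Fin 2 → ℝ) (W : Matrix (Fin 2) (Fin 2) ℂ) : ℝ :=
  K φ / Real.pi * Real.exp (-(1 / 2) * ((W 0 0).re * s φ 0 + (W 1 1).re * s φ 1))
    * sinhc (1 / 2 * √(D φ W))

end GramGaussian

end

/-!
# The density of the Gram matrix of a `2 × 2` complex Gaussian matrix

The law of `W = H Hᴴ` is computed by changing variables in the integral of the joint density of
the entries of `H` and integrating out the fibres of `H ↦ H Hᴴ`.

Let `v` be the first row of `H` and `w` its squared norm. The second row is expanded in the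
orthogonal frame `v, (-v̄₂, v̄₁)`; its coordinates are, up to the factor `1 / w`, the conjugate of
the off-diagonal entry `z` of `W` and a complex number `u` with `|u|² = w y - |z|²`, where `y` is
the squared norm of the second row. In polar coordinates for `v` and `u`, Lebesgue measure on the
entries becomes `1 / 8` times Lebesgue measure in `(w, y, z)`, the phase of `u` and the
parameters `(t, α, β)` of the direction of `v` (`lintegral_complex_prod_eq_polar`,
`lintegral_eq_secondRow`). The matrices `W` reached are the positive definite ones.

In these coordinates the joint density is a function of `w, y` times the exponential of a traceless
Hermitian form in `(v₁, v̄₂) / √w` (`entriesDensity_secondRow`), and the eigenvalues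
of this form are `± √(D W) / 2` (`sqrt_coeff_eq`). By unitary invariance the average of the
exponential over the unit sphere of `ℂ²` may be computed for the diagonal form with the same
eigenvalues `± R`, where it is `∫₀¹ exp (R (2 t - 1)) dt = sinh R / R`
(`lintegral_sphere_exp_sphereForm`). Unitary invariance of the sphere is inherited from Lebesgue
measure on `ℂ²` by integrating against a Gaussian weight.

The inequality `0 ≤ D W` follows from `|z|² ≤ w y`: if `ε₁ ε₂ < 0`, then
`D W ≥ (w ε₁ - y ε₂)² + 4 w y ε₁ ε₂ = (w ε₁ + y ε₂)²`.
-/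

namespace GramGaussian

open Set Complex ComplexConjugate

/-! ### Polar coordinates -/

theorem setLIntegral_Ioi_eq_sq (g : ℝ → ENNReal) :
    ∫⁻ x in Ioi 0, g x = ∫⁻ r in Ioi (0 : ℝ), ENNReal.ofReal (2 * r) * g (r ^ 2) := by
  have himg : (fun r : ℝ => r ^ 2) '' Ioi 0 = Ioi 0 := by
    ext x
    constructor
    · rintro ⟨r, hr, rfl⟩
      exact pow_pos (mem_Ioi.1 hr) 2
    · intro hx
      exact ⟨√x, Real.sqrt_pos.2 hx, Real.sq_sqrt (le_of_lt hx)⟩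
  have hinj : InjOn (fun r : ℝ => r ^ 2) (Ioi 0) := fun x hx y hy h =>
    (pow_left_inj₀ (le_of_lt hx) (le_of_lt hy) two_ne_zero).1 h
  have h := lintegral_image_eq_lintegral_abs_deriv_mul (s := Ioi (0 : ℝ))
    (f := fun r => r ^ 2) (f' := fun r => 2 * r) measurableSet_Ioi
    (fun x _ => by simpa using (hasDerivAt_pow 2 x).hasDerivWithinAt) hinj g
  rw [himg] at h
  rw [h]
  refine setLIntegral_congr_fun measurableSet_Ioi fun r hr => ?_
  have : |2 * r| = 2 * r := abs_of_pos (by have := mem_Ioi.1 hr; positivity)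
  simp only [this]

theorem setLIntegral_image_affine (g : ℝ → ENNReal) {a : ℝ} (ha : 0 < a) (b : ℝ) {S : Set ℝ}
    (hS : MeasurableSet S) :
    ∫⁻ x in (fun t => a * t + b) '' S, g x = ∫⁻ t in S, ENNReal.ofReal a * g (a * t + b) := by
  have h := lintegral_image_eq_lintegral_abs_deriv_mul (s := S)
    (f := fun t => a * t + b) (f' := fun _ => a) hS
    (fun x _ => by simpa using (((hasDerivAt_id x).const_mul a).add_const b).hasDerivWithinAt)
    (fun x _ y _ h => by simpa [ha.ne'] using h) g
  rw [h, abs_of_pos ha]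

/-- Polar coordinates on `ℂ` with the squared modulus as radial coordinate. -/
theorem lintegral_complex_eq_polar (G : ℂ → ENNReal) (hG : Measurable G) :
    ∫⁻ z, G z = ∫⁻ x in Ioi (0 : ℝ), ∫⁻ α in Ioo (-Real.pi) Real.pi,
      ENNReal.ofReal (1 / 2) * G (√x * cexp (α * I)) := by
  rw [setLIntegral_Ioi_eq_sq, ← Complex.lintegral_comp_polarCoord_symm,
    show polarCoord.target = Ioi (0 : ℝ) ×ˢ Ioo (-Real.pi) Real.pi from rfl,
    Measure.volume_eq_prod, ← Measure.prod_restrict, lintegral_prod]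
  · refine setLIntegral_congr_fun measurableSet_Ioi fun r hr => ?_
    have hr' : 0 < r := hr
    simp only
    rw [← lintegral_const_mul _ (by fun_prop)]
    refine lintegral_congr fun α => ?_
    rw [Complex.polarCoord_symm_apply, Real.sqrt_sq hr'.le, ← mul_assoc,
      ← ENNReal.ofReal_mul (by positivity), exp_mul_I]
    simp [show 2 * r * 2⁻¹ = r by ring]
  · have : Measurable fun p : ℝ × ℝ => (Complex.polarCoord.symm p : ℂ) := by
      simp only [Complex.polarCoord_symm_apply]; fun_prop
    exact Measurable.aemeasurable (by fun_prop)

/-- The coordinates `w = x + y`, `t = x / (x + y)` on the positive quadrant. -/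
theorem setLIntegral_quadrant (G : ℝ → ℝ → ENNReal) (hG : Measurable (Function.uncurry G)) :
    ∫⁻ x in Ioi (0 : ℝ), ∫⁻ y in Ioi (0 : ℝ), G x y =
      ∫⁻ w in Ioi (0 : ℝ), ∫⁻ t in Ioo (0 : ℝ) 1,
        ENNReal.ofReal w * G (w * t) (w * (1 - t)) := by
  have key : ∀ x w : ℝ, (Ioi 0).indicator (fun x => (Ioi 0).indicator (G x) (w - x)) x =
      (Ioi 0).indicator (fun w => (Ioo 0 w).indicator (fun x => G x (w - x)) x) w := by
    intro x w
    simp only [indicator, mem_Ioi, mem_Ioo, sub_pos]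
    split_ifs <;> first | rfl | (exfalso; grind)
  have hGm : ∀ x, Measurable (G x) := fun x => by
    have : Measurable fun y => Function.uncurry G (x, y) := by fun_prop
    exact this
  calc ∫⁻ x in Ioi (0 : ℝ), ∫⁻ y in Ioi (0 : ℝ), G x y
      = ∫⁻ x, ∫⁻ w, (Ioi 0).indicator (fun x => (Ioi 0).indicator (G x) (w - x)) x := by
        rw [← lintegral_indicator measurableSet_Ioi]
        refine lintegral_congr fun x => ?_
        by_cases hx : x ∈ Ioi (0 : ℝ)
        · simp only [indicator_of_mem hx]
          rw [← lintegral_indicator measurableSet_Ioi,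
            ← lintegral_sub_right_eq_self (fun y => (Ioi 0).indicator (G x) y) x]
        · simp [indicator_of_notMem hx]
    _ = ∫⁻ w, ∫⁻ x, (Ioi 0).indicator (fun x => (Ioi 0).indicator (G x) (w - x)) x := by
        apply lintegral_lintegral_swap
        have hm : Measurable fun p : ℝ × ℝ => Function.uncurry G (p.1, p.2 - p.1) := by fun_prop
        have h1 : MeasurableSet {p : ℝ × ℝ | 0 < p.1 ∧ 0 < p.2 - p.1} :=
          (measurableSet_lt measurable_const measurable_fst).inter
            (measurableSet_lt measurable_const (measurable_snd.sub measurable_fst))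
        convert (hm.indicator h1).aemeasurable using 1
        ext ⟨x, w⟩
        simp only [Function.uncurry, indicator, mem_Ioi, mem_ofPred_eq]
        split_ifs <;> first | rfl | (exfalso; grind)
    _ = _ := by
        simp only [key]
        rw [← lintegral_indicator measurableSet_Ioi]
        refine lintegral_congr fun w => ?_
        by_cases hw : w ∈ Ioi (0 : ℝ)
        · have hw' : 0 < w := hw
          simp only [indicator_of_mem hw]
          rw [lintegral_indicator measurableSet_Ioo]
          have himg : (fun t => w * t + 0) '' Ioo 0 1 = Ioo 0 w := by
            ext x
            constructor
            · rintro ⟨t, ⟨h0, h1⟩, rfl⟩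
              constructor <;> simp only [add_zero]
              · positivity
              · nlinarith
            · rintro ⟨h0, h1⟩
              exact ⟨x / w, ⟨by positivity, (div_lt_one hw').2 h1⟩, by field_simp; simp⟩
          rw [← himg, setLIntegral_image_affine _ hw' 0 measurableSet_Ioo]
          simp only [add_zero, mul_sub, mul_one]
        · simp [indicator_of_notMem hw]

/-- Polar coordinates on `ℂ²`: `w` is the squared norm, the direction is given by `t ∈ (0, 1)` and
two phases. -/
theorem lintegral_complex_prod_eq_polar (F : ℂ × ℂ → ENNReal) (hF : Measurable F) :
    ∫⁻ v, F v = ∫⁻ w in Ioi (0 : ℝ), ∫⁻ t in Ioo (0 : ℝ) 1,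
      ∫⁻ α in Ioo (-Real.pi) Real.pi, ∫⁻ β in Ioo (-Real.pi) Real.pi,
        ENNReal.ofReal (w / 4) *
          F (√(w * t) * cexp (α * I), √(w * (1 - t)) * cexp (β * I)) := by
  have h4 : ENNReal.ofReal (1 / 2) * ENNReal.ofReal (1 / 2) = ENNReal.ofReal (1 / 4) := by
    rw [← ENNReal.ofReal_mul (by norm_num)]; norm_num
  calc ∫⁻ v, F v = ∫⁻ a, ∫⁻ b, F (a, b) := by
        rw [Measure.volume_eq_prod, lintegral_prod _ hF.aemeasurable]
    _ = ∫⁻ x in Ioi (0 : ℝ), ∫⁻ α in Ioo (-Real.pi) Real.pi,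
        ENNReal.ofReal (1 / 2) * ∫⁻ b, F (√x * cexp (α * I), b) :=
        lintegral_complex_eq_polar _ hF.lintegral_prod_right'
    _ = ∫⁻ x in Ioi (0 : ℝ), ∫⁻ y in Ioi (0 : ℝ),
        ∫⁻ α in Ioo (-Real.pi) Real.pi, ∫⁻ β in Ioo (-Real.pi) Real.pi,
          ENNReal.ofReal (1 / 4) * F (√x * cexp (α * I), √y * cexp (β * I)) := by
        refine lintegral_congr fun x => ?_
        rw [lintegral_lintegral_swap]
        · refine lintegral_congr fun α => ?_
          rw [lintegral_complex_eq_polar _ (by fun_prop), ← lintegral_const_mul]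
          · refine lintegral_congr fun y => ?_
            rw [← lintegral_const_mul _ (by fun_prop)]
            simp only [← mul_assoc, h4]
          · refine Measurable.lintegral_prod_right' (f := fun p : ℝ × ℝ => ENNReal.ofReal (1 / 2) *
              F (√x * cexp (α * I), √p.1 * cexp (p.2 * I))) (by fun_prop)
        · refine (Measurable.lintegral_prod_right' (f := fun p : (ℝ × ℝ) × ℝ =>
            ENNReal.ofReal (1 / 4) *
              F (√x * cexp (p.1.2 * I), √p.1.1 * cexp (p.2 * I))) (by fun_prop)).aemeasurable
    _ = _ := by
        rw [setLIntegral_quadrant]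
        · refine setLIntegral_congr_fun measurableSet_Ioi fun w hw => ?_
          have hw' : 0 < w := hw
          refine lintegral_congr fun t => ?_
          rw [← lintegral_const_mul]
          · refine lintegral_congr fun α => ?_
            rw [← lintegral_const_mul _ (by fun_prop)]
            refine lintegral_congr fun β => ?_
            rw [← mul_assoc, ← ENNReal.ofReal_mul hw'.le]
            ring_nf
          · exact Measurable.lintegral_prod_right' (f := fun p : ℝ × ℝ => ENNReal.ofReal (1 / 4) *
              F (√(w * t) * cexp (p.1 * I), √(w * (1 - t)) * cexp (p.2 * I))) (by fun_prop)
        · refine Measurable.lintegral_prod_right' (f := fun q : (ℝ × ℝ) × ℝ =>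
            ∫⁻ β in Ioo (-Real.pi) Real.pi, ENNReal.ofReal (1 / 4) *
              F (√q.1.1 * cexp (q.2 * I), √q.1.2 * cexp (β * I))) ?_
          exact Measurable.lintegral_prod_right' (f := fun q : ((ℝ × ℝ) × ℝ) × ℝ =>
            ENNReal.ofReal (1 / 4) *
              F (√q.1.1.1 * cexp (q.1.2 * I), √q.1.1.2 * cexp (q.2 * I))) (by fun_prop)

/-! ### Linear changes of variables on `ℂ²` -/

/-- The map `(x, u) ↦ x (a, b) + u (-b̄, ā)`. -/
def frameMap (a b : ℂ) (p : ℂ × ℂ) : ℂ × ℂ :=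
  (p.1 * a - p.2 * conj b, p.1 * b + p.2 * conj a)

theorem lintegral_comp_frameMap (a b : ℂ) (h : 0 < ‖a‖ ^ 2 + ‖b‖ ^ 2) (G : ℂ × ℂ → ENNReal)
    (hG : Measurable G) :
    ∫⁻ p, G p = ENNReal.ofReal ((‖a‖ ^ 2 + ‖b‖ ^ 2) ^ 2) * ∫⁻ p, G (frameMap a b p) := by
  set f : (ℂ × ℂ) →ₗ[ℂ] (ℂ × ℂ) := Matrix.toLin (Module.Basis.finTwoProd ℂ)
    (Module.Basis.finTwoProd ℂ) !![a, -conj b; b, conj a] with hf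
  have hfa : ∀ p, (f.restrictScalars ℝ) p = frameMap a b p := by
    intro p
    rw [LinearMap.restrictScalars_apply, hf, Matrix.toLin_finTwoProd_apply]
    simp only [frameMap, Prod.mk.injEq]
    constructor <;> ring
  -- The complex determinant is `|a|² + |b|²`; the real one is its squared modulus.
  have hdet : LinearMap.det (f.restrictScalars ℝ) = (‖a‖ ^ 2 + ‖b‖ ^ 2) ^ 2 := by
    have hc : a * conj a + conj b * b = ((‖a‖ ^ 2 + ‖b‖ ^ 2 : ℝ) : ℂ) := by
      rw [mul_conj, conj_mul', normSq_eq_norm_sq]; push_cast; ring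
    rw [LinearMap.det_restrictScalars, hf, LinearMap.det_toLin, Matrix.det_fin_two_of,
      Algebra.norm_complex_apply, neg_mul, sub_neg_eq_add, hc, normSq_ofReal]
    ring
  have hmeas : Measurable (frameMap a b) := by unfold frameMap; fun_prop
  have h0 : (0 : ℝ) < (‖a‖ ^ 2 + ‖b‖ ^ 2) ^ 2 := by positivity
  have : (volume : Measure (ℂ × ℂ)).IsAddHaarMeasure :=
    inferInstanceAs ((volume : Measure ℂ).prod (volume : Measure ℂ)).IsAddHaarMeasure
  have hmap := Measure.map_linearMap_addHaar_eq_smul_addHaar (volume : Measure (ℂ × ℂ))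
    (f := f.restrictScalars ℝ) (by rw [hdet]; exact h0.ne')
  rw [show ⇑(f.restrictScalars ℝ) = frameMap a b from funext hfa, hdet] at hmap
  rw [← lintegral_map hG hmeas, hmap, lintegral_smul_measure, smul_eq_mul, ← mul_assoc,
    abs_of_pos (by positivity), ← ENNReal.ofReal_mul h0.le, mul_inv_cancel₀ h0.ne',
    ENNReal.ofReal_one, one_mul]

theorem lintegral_comp_conj_snd (G : ℂ × ℂ → ENNReal) (hG : Measurable G) :
    ∫⁻ p : ℂ × ℂ, G (p.1, conj p.2) = ∫⁻ p, G p :=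
  ((MeasurePreserving.id (volume : Measure ℂ)).prod
    conjLIE.measurePreserving).lintegral_comp hG

/-! ### The spherical average of an exponential -/

/-- The function on `ℂ² ∖ {0}`, homogeneous of degree `0`, that is
`A (|z₁|² - |z₂|²) + 2 Re (B z₁ z₂)` on the unit sphere. It is a traceless Hermitian form in
`(z₁, z̄₂)`. -/
noncomputable def sphereForm (A : ℝ) (B : ℂ) (p : ℂ × ℂ) : ℝ :=
  (A * (‖p.1‖ ^ 2 - ‖p.2‖ ^ 2) + 2 * (B * p.1 * p.2).re) / (‖p.1‖ ^ 2 + ‖p.2‖ ^ 2)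

theorem measurable_sphereForm (A : ℝ) (B : ℂ) : Measurable (sphereForm A B) := by
  unfold sphereForm
  fun_prop

theorem norm_sq_add_frameMap (p q : ℂ) (v : ℂ × ℂ) :
    ‖(frameMap p q v).1‖ ^ 2 + ‖(frameMap p q v).2‖ ^ 2 =
      (‖p‖ ^ 2 + ‖q‖ ^ 2) * (‖v.1‖ ^ 2 + ‖v.2‖ ^ 2) := by
  apply ofReal_injective
  push_cast
  simp only [← mul_conj', frameMap, map_add, map_sub, map_mul, conj_conj]
  ring

/-- Diagonalization of the traceless Hermitian form `A (|z₁|² - |z₂|²) + 2 Re (B z₁ z̄₂)` by a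
unitary change of variables: its eigenvalues are `± √(A² + |B|²)`. -/
theorem exists_frameMap_diagonalizing (A : ℝ) (B : ℂ) :
    ∃ p q : ℂ, ‖p‖ ^ 2 + ‖q‖ ^ 2 = 1 ∧ ∀ v : ℂ × ℂ,
      A * (‖(frameMap p q v).1‖ ^ 2 - ‖(frameMap p q v).2‖ ^ 2) +
        2 * (B * (frameMap p q v).1 * conj (frameMap p q v).2).re =
      √(A ^ 2 + ‖B‖ ^ 2) * (‖v.1‖ ^ 2 - ‖v.2‖ ^ 2) := by
  set R := √(A ^ 2 + ‖B‖ ^ 2) with hR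
  have hR2 : R ^ 2 = A ^ 2 + ‖B‖ ^ 2 := Real.sq_sqrt (by positivity)
  have hR0 : 0 ≤ R := Real.sqrt_nonneg _
  -- A unit eigenvector `(p, q)` for the eigenvalue `R`.
  obtain ⟨p, q, hN, e1, e2⟩ : ∃ p q : ℂ, ‖p‖ ^ 2 + ‖q‖ ^ 2 = 1 ∧
      A * p + conj B * q = R * p ∧ B * p - A * q = R * q := by
    by_cases h0 : (A + R) ^ 2 + ‖B‖ ^ 2 = 0
    · have hA : A + R = 0 := by nlinarith [sq_nonneg (A + R), sq_nonneg ‖B‖]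
      have hB : B = 0 := by
        rw [← norm_eq_zero]; nlinarith [sq_nonneg (A + R), sq_nonneg ‖B‖]
      refine ⟨0, 1, by simp, by simp [hB], ?_⟩
      have : R = -A := by linarith
      simp [this]
    · have hpos : 0 < (A + R) ^ 2 + ‖B‖ ^ 2 := lt_of_le_of_ne (by positivity) (Ne.symm h0)
      set N := √((A + R) ^ 2 + ‖B‖ ^ 2) with hNdef
      have hN2 : N ^ 2 = (A + R) ^ 2 + ‖B‖ ^ 2 := Real.sq_sqrt hpos.le
      have hN0 : 0 < N := Real.sqrt_pos.2 hpos
      have hNc : (N : ℂ) ≠ 0 := ofReal_ne_zero.2 hN0.ne'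
      have hR2c : (R : ℂ) ^ 2 = A ^ 2 + conj B * B := by
        rw [conj_mul']; exact_mod_cast hR2
      refine ⟨((A + R : ℝ) : ℂ) / N, B / N, ?_, ?_, ?_⟩
      · simp only [norm_div, norm_real, Real.norm_eq_abs, div_pow, sq_abs]
        rw [← add_div, hN2, div_self h0]
      · field_simp
        push_cast
        linear_combination -hR2c
      · field_simp
        push_cast
        ring
  refine ⟨p, q, hN, fun v => ?_⟩
  have e1' : (A : ℂ) * conj p + B * conj q = R * conj p := by
    simpa using congrArg conj e1
  have e2' : conj B * conj p - A * conj q = R * conj q := by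
    simpa using congrArg conj e2
  have hN' : p * conj p + q * conj q = 1 := by
    rw [mul_conj', mul_conj']; exact_mod_cast hN
  apply ofReal_injective
  have hre : ∀ z : ℂ, ((2 * z.re : ℝ) : ℂ) = z + conj z := fun z => (add_conj z).symm
  rw [ofReal_add, hre]
  push_cast
  simp only [← mul_conj', frameMap, map_add, map_sub, map_mul, conj_conj]
  linear_combination
    (conj v.1 * conj p - conj v.2 * q) * (v.1 * e1 + v.2 * e2') +
    (conj v.1 * conj q + conj v.2 * p) * (v.1 * e2 - v.2 * e1') +
    R * (v.1 * conj v.1 - v.2 * conj v.2) * hN'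

/-- The integral of `exp (sphereForm A B)` against a radial weight depends only on
`A² + |B|²`, by unitary invariance of Lebesgue measure on `ℂ²`. -/
theorem lintegral_radial_mul_exp_sphereForm (k : ℝ → ENNReal) (hk : Measurable k) (A : ℝ) (B : ℂ) :
    ∫⁻ v : ℂ × ℂ, k (‖v.1‖ ^ 2 + ‖v.2‖ ^ 2) * ENNReal.ofReal (Real.exp (sphereForm A B v)) =
      ∫⁻ v : ℂ × ℂ, k (‖v.1‖ ^ 2 + ‖v.2‖ ^ 2) *
        ENNReal.ofReal (Real.exp (sphereForm √(A ^ 2 + ‖B‖ ^ 2) 0 v)) := by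
  obtain ⟨p, q, hN, hpq⟩ := exists_frameMap_diagonalizing A B
  have hm := measurable_sphereForm A B
  -- Conjugating `z₂` makes the form Hermitian in `(z₁, z₂)`.
  rw [← lintegral_comp_conj_snd _ (by fun_prop), lintegral_comp_frameMap p q (by simp [hN])]
  · rw [hN, one_pow, ENNReal.ofReal_one, one_mul]
    refine lintegral_congr fun v => ?_
    have hn := norm_sq_add_frameMap p q v
    rw [hN, one_mul] at hn
    simp only [sphereForm, norm_conj, hpq, hn, zero_mul, zero_re, mul_zero, add_zero]
  · fun_prop

theorem sphereForm_polar (A : ℝ) (B : ℂ) {w t : ℝ} (hw : 0 < w) (ht : t ∈ Ioo (0 : ℝ) 1)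
    (α β : ℝ) :
    sphereForm A B (√(w * t) * cexp (α * I), √(w * (1 - t)) * cexp (β * I)) =
      sphereForm A B (√t * cexp (α * I), √(1 - t) * cexp (β * I)) := by
  have h1 : √(w * t) = √w * √t := Real.sqrt_mul hw.le _
  have h2 : √(w * (1 - t)) = √w * √(1 - t) := Real.sqrt_mul hw.le _
  have hs : 0 < √w := Real.sqrt_pos.2 hw
  have hB : B * (((√w * √t : ℝ) : ℂ) * cexp (α * I)) * (((√w * √(1 - t) : ℝ) : ℂ) * cexp (β * I)) =
      ((√w ^ 2 : ℝ) : ℂ) * (B * (√t * cexp (α * I)) * (√(1 - t) * cexp (β * I))) := by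
    push_cast; ring
  rw [h1, h2]
  simp only [sphereForm]
  rw [hB, re_ofReal_mul]
  simp only [norm_mul, norm_real, norm_exp_ofReal_mul_I, mul_one, Real.norm_eq_abs, mul_pow,
    sq_abs]
  have hD : √t ^ 2 + √(1 - t) ^ 2 = 1 := by
    rw [Real.sq_sqrt ht.1.le, Real.sq_sqrt (by linarith [ht.2])]; ring
  rw [← mul_add (√w ^ 2), hD]
  field_simp

theorem norm_polar_sq {x : ℝ} (hx : 0 ≤ x) (α : ℝ) : ‖(√x : ℂ) * cexp (α * I)‖ ^ 2 = x := by
  rw [norm_mul, norm_exp_ofReal_mul_I, mul_one, norm_real, Real.norm_eq_abs, sq_abs,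
    Real.sq_sqrt hx]

theorem lintegral_exp_affine (R : ℝ) :
    ∫⁻ t in Ioo (0 : ℝ) 1, ENNReal.ofReal (Real.exp (R * (2 * t - 1))) =
      ENNReal.ofReal (sinhc R) := by
  have hc : Continuous fun t : ℝ => Real.exp (R * (2 * t - 1)) := by fun_prop
  rw [← ofReal_integral_eq_lintegral_ofReal
    ((hc.integrableOn_Icc (a := 0) (b := 1)).mono_set Ioo_subset_Icc_self)
    (Filter.Eventually.of_forall fun t => (Real.exp_pos _).le),
    ← integral_Ioc_eq_integral_Ioo, ← intervalIntegral.integral_of_le zero_le_one]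
  congr 1
  by_cases hR : R = 0
  · simp [hR, sinhc]
  · rw [intervalIntegral.integral_eq_sub_of_hasDerivAt
      (f := fun t => Real.exp (R * (2 * t - 1)) / (2 * R)) _ (hc.intervalIntegrable _ _)]
    · simp only [sinhc, hR, if_false, Real.sinh_eq]
      field_simp
      ring_nf
    · intro t _
      have := (((((hasDerivAt_id t).const_mul 2).sub_const 1).const_mul R).exp).div_const (2 * R)
      refine this.congr_deriv ?_
      simp only [id, mul_one]
      field_simp

theorem lintegral_exp_neg_mul_quarter :
    ∫⁻ w in Ioi (0 : ℝ), ENNReal.ofReal (w / 4) * ENNReal.ofReal (Real.exp (-w)) =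
      ENNReal.ofReal (1 / 4) := by
  have h := Real.GammaIntegral_convergent (s := 2) two_pos
  have hi : ∫ w in Ioi (0 : ℝ), Real.exp (-w) * w ^ ((2 : ℝ) - 1) = 1 := by
    rw [← Real.Gamma_eq_integral two_pos, Real.Gamma_two]
  rw [show (1 / 4 : ℝ) = 1 / 4 * ∫ w in Ioi (0 : ℝ), Real.exp (-w) * w ^ ((2 : ℝ) - 1) by
      rw [hi, mul_one], ← integral_const_mul,
    ofReal_integral_eq_lintegral_ofReal (h.const_mul _)]
  · refine setLIntegral_congr_fun measurableSet_Ioi fun w hw => ?_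
    have hw' : (0 : ℝ) < w := hw
    rw [← ENNReal.ofReal_mul (by positivity), show (2 : ℝ) - 1 = 1 by norm_num, Real.rpow_one]
    ring_nf
  · refine (ae_restrict_mem measurableSet_Ioi).mono fun w hw => ?_
    have hw' : (0 : ℝ) < w := hw
    change 0 ≤ 1 / 4 * (Real.exp (-w) * w ^ ((2 : ℝ) - 1))
    positivity

/-- The integral of `exp` of a traceless Hermitian form over the directions in `ℂ²`, in polar
coordinates, where the directions have total mass `(2 π)²`. -/
theorem lintegral_sphere_exp_sphereForm (A : ℝ) (B : ℂ) {w : ℝ} (hw : 0 < w) :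
    ∫⁻ t in Ioo (0 : ℝ) 1, ∫⁻ α in Ioo (-Real.pi) Real.pi, ∫⁻ β in Ioo (-Real.pi) Real.pi,
      ENNReal.ofReal (Real.exp (sphereForm A B
        (√(w * t) * cexp (α * I), √(w * (1 - t)) * cexp (β * I)))) =
      ENNReal.ofReal ((2 * Real.pi) ^ 2 * sinhc √(A ^ 2 + ‖B‖ ^ 2)) := by
  set S : ℝ → ℂ → ENNReal := fun A B => ∫⁻ t in Ioo (0 : ℝ) 1, ∫⁻ α in Ioo (-Real.pi) Real.pi,
    ∫⁻ β in Ioo (-Real.pi) Real.pi, ENNReal.ofReal (Real.exp (sphereForm A B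
        (√t * cexp (α * I), √(1 - t) * cexp (β * I)))) with hS
  -- Gaussian integration over `ℂ²` recovers the spherical average up to the factor `1 / 4`.
  have hT : ∀ A B, ∫⁻ v : ℂ × ℂ, ENNReal.ofReal (Real.exp (-(‖v.1‖ ^ 2 + ‖v.2‖ ^ 2))) *
      ENNReal.ofReal (Real.exp (sphereForm A B v)) = ENNReal.ofReal (1 / 4) * S A B := by
    intro A B
    have hm := measurable_sphereForm A B
    rw [lintegral_complex_prod_eq_polar _ (by fun_prop), ← lintegral_exp_neg_mul_quarter,
      ← lintegral_mul_const _ (by fun_prop)]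
    refine setLIntegral_congr_fun measurableSet_Ioi fun w hw => ?_
    have hw' : (0 : ℝ) < w := hw
    simp only [hS]
    rw [← lintegral_const_mul]
    · refine setLIntegral_congr_fun measurableSet_Ioo fun t ht => ?_
      rw [← lintegral_const_mul]
      · refine lintegral_congr fun α => ?_
        rw [← lintegral_const_mul _ (by fun_prop)]
        refine lintegral_congr fun β => ?_
        rw [sphereForm_polar A B hw' ht, norm_polar_sq (mul_nonneg hw'.le ht.1.le),
          norm_polar_sq (mul_nonneg hw'.le (by linarith [ht.2])), ← mul_add, add_sub_cancel,
          mul_one, mul_assoc]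
      · exact Measurable.lintegral_prod_right' (f := fun p : ℝ × ℝ =>
          ENNReal.ofReal (Real.exp (sphereForm A B
            (√t * cexp (p.1 * I), √(1 - t) * cexp (p.2 * I))))) (by fun_prop)
    · refine Measurable.lintegral_prod_right' (f := fun q : ℝ × ℝ =>
        ∫⁻ β in Ioo (-Real.pi) Real.pi, ENNReal.ofReal (Real.exp (sphereForm A B
            (√q.1 * cexp (q.2 * I), √(1 - q.1) * cexp (β * I))))) ?_
      exact Measurable.lintegral_prod_right' (f := fun q : (ℝ × ℝ) × ℝ =>
        ENNReal.ofReal (Real.exp (sphereForm A B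
            (√q.1.1 * cexp (q.1.2 * I), √(1 - q.1.1) * cexp (q.2 * I))))) (by fun_prop)
  have hSR : ∀ R : ℝ, S R 0 = ENNReal.ofReal ((2 * Real.pi) ^ 2 * sinhc R) := by
    intro R
    have h2π : volume (Ioo (-Real.pi) Real.pi) = ENNReal.ofReal (2 * Real.pi) := by
      rw [Real.volume_Ioo]; ring_nf
    rw [ENNReal.ofReal_mul (by positivity), ← lintegral_exp_affine,
      ← lintegral_const_mul _ (by fun_prop)]
    refine setLIntegral_congr_fun measurableSet_Ioo fun t ht => ?_
    have h0 : ∀ α β : ℝ, sphereForm R 0 (√t * cexp (α * I), √(1 - t) * cexp (β * I)) =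
        R * (2 * t - 1) := by
      intro α β
      simp only [sphereForm]
      rw [norm_polar_sq ht.1.le, norm_polar_sq (by linarith [ht.2])]
      simp only [zero_mul, zero_re]
      ring
    simp only [h0, lintegral_const, Measure.restrict_apply_univ, h2π]
    rw [ENNReal.ofReal_pow (by positivity)]
    ring
  have hmain : S A B = S √(A ^ 2 + ‖B‖ ^ 2) 0 := by
    have h := lintegral_radial_mul_exp_sphereForm
      (fun x => ENNReal.ofReal (Real.exp (-x))) (by fun_prop) A B
    rw [hT, hT] at h
    exact (ENNReal.mul_right_inj (by norm_num) ENNReal.ofReal_ne_top).1 h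
  rw [← hSR, ← hmain]
  refine setLIntegral_congr_fun measurableSet_Ioo fun t ht => ?_
  simp only [sphereForm_polar A B hw ht]

/-! ### The second row in the frame of the first row -/

/-- The second row of a matrix with first row `v` of squared norm `w`, whose coordinates in the
orthogonal frame `v / w, (-v̄₂, v̄₁) / w` are `z̄` and `u`. -/
noncomputable def secondRow (w : ℝ) (v : ℂ × ℂ) (z u : ℂ) : ℂ × ℂ :=
  frameMap (v.1 / w) (v.2 / w) (conj z, u)

theorem norm_sq_secondRow {w : ℝ} (hw : 0 < w) {v : ℂ × ℂ} (hv : ‖v.1‖ ^ 2 + ‖v.2‖ ^ 2 = w)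
    (z u : ℂ) :
    ‖(secondRow w v z u).1‖ ^ 2 + ‖(secondRow w v z u).2‖ ^ 2 = (‖z‖ ^ 2 + ‖u‖ ^ 2) / w := by
  rw [secondRow, norm_sq_add_frameMap]
  simp only [norm_div, norm_conj, norm_real, Real.norm_eq_abs, div_pow, sq_abs]
  rw [← add_div, hv]
  field_simp

theorem inner_secondRow {w : ℝ} (hw : 0 < w) {v : ℂ × ℂ} (hv : ‖v.1‖ ^ 2 + ‖v.2‖ ^ 2 = w)
    (z u : ℂ) :
    v.1 * conj (secondRow w v z u).1 + v.2 * conj (secondRow w v z u).2 = z := by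
  have hc : v.1 * conj v.1 + v.2 * conj v.2 = w := by
    rw [mul_conj', mul_conj']; exact_mod_cast hv
  have hw' : (w : ℂ) ≠ 0 := ofReal_ne_zero.2 hw.ne'
  simp only [secondRow, frameMap, map_add, map_sub, map_mul, map_div₀, conj_conj, conj_ofReal]
  field_simp
  linear_combination z * hc

theorem norm_sq_sub_secondRow {w : ℝ} (hw : 0 < w) (v : ℂ × ℂ) (z u : ℂ) :
    ‖(secondRow w v z u).1‖ ^ 2 - ‖(secondRow w v z u).2‖ ^ 2 =
      ((‖z‖ ^ 2 - ‖u‖ ^ 2) * (‖v.1‖ ^ 2 - ‖v.2‖ ^ 2) -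
        4 * (conj (z * u) * v.1 * v.2).re) / w ^ 2 := by
  have hw' : (w : ℂ) ≠ 0 := ofReal_ne_zero.2 hw.ne'
  apply ofReal_injective
  have hre : ∀ x : ℂ, ((4 * x.re : ℝ) : ℂ) = 2 * (x + conj x) := fun x => by
    rw [add_conj]; push_cast; ring
  rw [ofReal_div, ofReal_sub, ofReal_sub, hre]
  push_cast
  simp only [← mul_conj', secondRow, frameMap, map_add, map_sub, map_mul, map_div₀, conj_conj,
    conj_ofReal]
  field_simp
  ring

/-- Integration over the second row, in terms of its inner product `z` with the first row and
polar coordinates for its orthogonal component. -/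
theorem lintegral_eq_secondRow {w : ℝ} (hw : 0 < w) {v : ℂ × ℂ}
    (hv : ‖v.1‖ ^ 2 + ‖v.2‖ ^ 2 = w) (G : ℂ × ℂ → ENNReal) (hG : Measurable G) :
    ∫⁻ p, G p = ENNReal.ofReal (1 / (2 * w ^ 2)) * ∫⁻ z : ℂ, ∫⁻ x in Ioi (0 : ℝ),
      ∫⁻ θ in Ioo (-Real.pi) Real.pi, G (secondRow w v z (√x * cexp (θ * I))) := by
  have hn : ‖v.1 / (w : ℂ)‖ ^ 2 + ‖v.2 / (w : ℂ)‖ ^ 2 = 1 / w := by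
    simp only [norm_div, norm_real, Real.norm_eq_abs, div_pow, sq_abs]
    rw [← add_div, hv]
    field_simp
  have hsm : Measurable fun p : ℂ × ℂ => secondRow w v p.1 p.2 := by
    unfold secondRow frameMap
    fun_prop
  have hfm : Measurable fun p : ℂ × ℂ => frameMap (v.1 / w) (v.2 / w) p := by
    unfold frameMap
    fun_prop
  rw [lintegral_comp_frameMap (v.1 / w) (v.2 / w) (by rw [hn]; positivity) G hG, hn]
  have hconj : ∫⁻ p : ℂ × ℂ, G (frameMap (v.1 / w) (v.2 / w) p) =
      ∫⁻ z : ℂ, ∫⁻ u : ℂ, G (secondRow w v z u) := by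
    rw [Measure.volume_eq_prod, lintegral_prod _ (by fun_prop)]
    have hm : Measurable fun z : ℂ => ∫⁻ u : ℂ, G (frameMap (v.1 / w) (v.2 / w) (z, u)) :=
      Measurable.lintegral_prod_right' (f := fun p : ℂ × ℂ => G (frameMap (v.1 / w) (v.2 / w) p))
        (by fun_prop)
    exact (conjLIE.measurePreserving.lintegral_comp hm).symm
  have hpolar : ∀ z : ℂ, ∫⁻ u : ℂ, G (secondRow w v z u) = ENNReal.ofReal (1 / 2) *
      ∫⁻ x in Ioi (0 : ℝ), ∫⁻ θ in Ioo (-Real.pi) Real.pi,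
        G (secondRow w v z (√x * cexp (θ * I))) := by
    intro z
    have hz : Measurable fun u => G (secondRow w v z u) := by fun_prop
    rw [lintegral_complex_eq_polar _ hz, ← lintegral_const_mul]
    · refine lintegral_congr fun x => ?_
      rw [← lintegral_const_mul _ (by fun_prop)]
    · exact Measurable.lintegral_prod_right' (f := fun p : ℝ × ℝ =>
        G (secondRow w v z (√p.1 * cexp (p.2 * I)))) (by fun_prop)
  simp only [hconj, hpolar]
  rw [lintegral_const_mul, ← mul_assoc, ← ENNReal.ofReal_mul (by positivity)]
  · congr 2
    field_simp
  · refine Measurable.lintegral_prod_right' (f := fun p : ℂ × ℝ =>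
      ∫⁻ θ in Ioo (-Real.pi) Real.pi, G (secondRow w v p.1 (√p.2 * cexp (θ * I)))) ?_
    exact Measurable.lintegral_prod_right' (f := fun p : (ℂ × ℝ) × ℝ =>
      G (secondRow w v p.1.1 (√p.1.2 * cexp (p.2 * I)))) (by fun_prop)

/-! ### The joint density of the entries in the new coordinates -/

/-- The density of the complex Gaussian law of variance `v`. -/
noncomputable def complexGaussianDensity (v : ℝ) (z : ℂ) : ℝ :=
  1 / (Real.pi * v) * Real.exp (-‖z‖ ^ 2 / v)

theorem complexGaussianDensity_nonneg {v : ℝ} (hv : 0 < v) (z : ℂ) :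
    0 ≤ complexGaussianDensity v z := by
  have := Real.pi_pos
  unfold complexGaussianDensity
  positivity

theorem measurable_complexGaussianDensity (v : ℝ) : Measurable (complexGaussianDensity v) := by
  unfold complexGaussianDensity
  fun_prop

/-- The joint density of the four entries of the matrix with rows `p` and `q`. -/
noncomputable def entriesDensity (φ : Fin 2 → Fin 2 → ℝ) (p q : ℂ × ℂ) : ℝ :=
  (complexGaussianDensity (φ 0 0) p.1 * complexGaussianDensity (φ 0 1) p.2) *
    (complexGaussianDensity (φ 1 0) q.1 * complexGaussianDensity (φ 1 1) q.2)

/-- With `w₁, w₂` the squared norms of the rows, the joint density depends on the rows otherwise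
only through the differences `|Hᵢ₁|² - |Hᵢ₂|²`. -/
theorem entriesDensity_eq (φ : Fin 2 → Fin 2 → ℝ) (p q : ℂ × ℂ) :
    entriesDensity φ p q = K φ / Real.pi ^ 4 *
      Real.exp (-(1 / 2) * ((‖p.1‖ ^ 2 + ‖p.2‖ ^ 2) * s φ 0 + (‖q.1‖ ^ 2 + ‖q.2‖ ^ 2) * s φ 1)) *
      Real.exp (-(1 / 2) * ((‖p.1‖ ^ 2 - ‖p.2‖ ^ 2) * ε φ 0 +
        (‖q.1‖ ^ 2 - ‖q.2‖ ^ 2) * ε φ 1)) := by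
  rw [mul_assoc, ← Real.exp_add]
  have h : entriesDensity φ p q = K φ / Real.pi ^ 4 * (Real.exp (-‖p.1‖ ^ 2 / φ 0 0) *
      Real.exp (-‖p.2‖ ^ 2 / φ 0 1) * Real.exp (-‖q.1‖ ^ 2 / φ 1 0) *
      Real.exp (-‖q.2‖ ^ 2 / φ 1 1)) := by
    simp only [entriesDensity, complexGaussianDensity, K, Fin.prod_univ_two, mul_inv,
      div_eq_mul_inv]
    ring
  rw [h, ← Real.exp_add, ← Real.exp_add, ← Real.exp_add]
  congr 2
  simp only [s, ε]
  ring

/-- Diagonal coefficient of the Hermitian form in the exponent of the joint density. -/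
noncomputable def diagCoeff (φ : Fin 2 → Fin 2 → ℝ) (w : ℝ) (z u : ℂ) : ℝ :=
  -(1 / 2) * (ε φ 0 * w + ε φ 1 * (‖z‖ ^ 2 - ‖u‖ ^ 2) / w)

/-- Off-diagonal coefficient of the Hermitian form in the exponent of the joint density. -/
noncomputable def offDiagCoeff (φ : Fin 2 → Fin 2 → ℝ) (w : ℝ) (z u : ℂ) : ℂ :=
  ((ε φ 1 / w : ℝ) : ℂ) * conj (z * u)

/-- The factor of the joint density that is determined by the Gram matrix with diagonal `w, y`. -/
noncomputable def radialFactor (φ : Fin 2 → Fin 2 → ℝ) (w y : ℝ) : ℝ :=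
  K φ / Real.pi ^ 4 * Real.exp (-(1 / 2) * (w * s φ 0 + y * s φ 1))

theorem radialFactor_nonneg {φ : Fin 2 → Fin 2 → ℝ} (hφ : ∀ i j, 0 < φ i j) (w y : ℝ) :
    0 ≤ radialFactor φ w y := by
  have hK : 0 ≤ K φ := Finset.prod_nonneg fun i _ => Finset.prod_nonneg fun j _ =>
    one_div_nonneg.2 (hφ i j).le
  unfold radialFactor
  positivity

theorem entriesDensity_secondRow (φ : Fin 2 → Fin 2 → ℝ) {w : ℝ} (hw : 0 < w) {v : ℂ × ℂ}
    (hv : ‖v.1‖ ^ 2 + ‖v.2‖ ^ 2 = w) (z u : ℂ) :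
    entriesDensity φ v (secondRow w v z u) = radialFactor φ w ((‖z‖ ^ 2 + ‖u‖ ^ 2) / w) *
      Real.exp (sphereForm (diagCoeff φ w z u) (offDiagCoeff φ w z u) v) := by
  rw [entriesDensity_eq, norm_sq_secondRow hw hv, norm_sq_sub_secondRow hw, hv,
    radialFactor]
  congr 2
  have hB : offDiagCoeff φ w z u * v.1 * v.2 =
      ((ε φ 1 / w : ℝ) : ℂ) * (conj (z * u) * v.1 * v.2) := by
    rw [offDiagCoeff]; ring
  rw [sphereForm, hv, hB, re_ofReal_mul, diagCoeff]
  field_simp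
  ring

/-- The discriminant `D` is the squared difference of the eigenvalues `± √(A² + |B|²)` of the
Hermitian form in the exponent of the joint density. -/
theorem sqrt_coeff_eq (φ : Fin 2 → Fin 2 → ℝ) {w : ℝ} (hw : 0 < w) (z u : ℂ) :
    √(diagCoeff φ w z u ^ 2 + ‖offDiagCoeff φ w z u‖ ^ 2) =
      1 / 2 * √(D φ (hermitianOf (w, (‖z‖ ^ 2 + ‖u‖ ^ 2) / w, z))) := by
  have h : D φ (hermitianOf (w, (‖z‖ ^ 2 + ‖u‖ ^ 2) / w, z)) =
      2 ^ 2 * (diagCoeff φ w z u ^ 2 + ‖offDiagCoeff φ w z u‖ ^ 2) := by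
    simp only [D, hermitianOf, diagCoeff, offDiagCoeff, norm_mul, norm_real, Real.norm_eq_abs,
      mul_pow, sq_abs, norm_conj, Matrix.of_apply, Matrix.cons_val', Matrix.cons_val_zero,
      Matrix.cons_val_one, Matrix.cons_val_fin_one, ofReal_re]
    field_simp
    ring
  rw [h, Real.sqrt_mul (by positivity), Real.sqrt_sq (by norm_num)]
  ring

/-! ### Integrating out the fibres of the Gram map -/

theorem sinhc_nonneg (x : ℝ) : 0 ≤ sinhc x := by
  unfold sinhc
  split_ifs
  · exact zero_le_one
  · rcases le_total 0 x with h | h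
    · exact div_nonneg (Real.sinh_nonneg_iff.2 h) h
    · exact div_nonneg_of_nonpos (Real.sinh_nonpos_iff.2 h) h

theorem measurable_sinhc : Measurable sinhc :=
  Measurable.ite (measurableSet_singleton 0) measurable_const (by fun_prop)

/-- Lebesgue measure on the parameters `(t, α, β)` of the directions in `ℂ²`. -/
noncomputable def directionMeasure : Measure (ℝ × ℝ × ℝ) :=
  (volume.restrict (Ioo 0 1)).prod
    ((volume.restrict (Ioo (-Real.pi) Real.pi)).prod (volume.restrict (Ioo (-Real.pi) Real.pi)))

/-- Lebesgue measure on the parameters `(z, x, θ)` of the second row, see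
`lintegral_eq_secondRow`. -/
noncomputable def secondRowMeasure : Measure (ℂ × ℝ × ℝ) :=
  (volume : Measure ℂ).prod
    ((volume.restrict (Ioi 0)).prod (volume.restrict (Ioo (-Real.pi) Real.pi)))

instance : SFinite directionMeasure := by unfold directionMeasure; infer_instance

instance : SFinite secondRowMeasure := by unfold secondRowMeasure; infer_instance

theorem lintegral_directionMeasure (X : ℝ × ℝ × ℝ → ENNReal) (hX : Measurable X) :
    ∫⁻ q, X q ∂directionMeasure = ∫⁻ t in Ioo (0 : ℝ) 1, ∫⁻ α in Ioo (-Real.pi) Real.pi,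
      ∫⁻ β in Ioo (-Real.pi) Real.pi, X (t, α, β) := by
  rw [directionMeasure, lintegral_prod _ hX.aemeasurable]
  refine lintegral_congr fun t => ?_
  rw [lintegral_prod _ (by fun_prop)]

theorem lintegral_secondRowMeasure (X : ℂ × ℝ × ℝ → ENNReal) (hX : Measurable X) :
    ∫⁻ q, X q ∂secondRowMeasure = ∫⁻ z, ∫⁻ x in Ioi (0 : ℝ),
      ∫⁻ θ in Ioo (-Real.pi) Real.pi, X (z, x, θ) := by
  rw [secondRowMeasure, lintegral_prod _ hX.aemeasurable]
  refine lintegral_congr fun t => ?_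
  rw [lintegral_prod _ (by fun_prop)]

/-- The point of `ℂ²` with squared norm `w` and direction parameters `q`. -/
noncomputable def polarVec (w : ℝ) (q : ℝ × ℝ × ℝ) : ℂ × ℂ :=
  (√(w * q.1) * cexp (q.2.1 * I), √(w * (1 - q.1)) * cexp (q.2.2 * I))

theorem measurable_polarVec (w : ℝ) : Measurable (polarVec w) := by
  unfold polarVec
  fun_prop

theorem norm_sq_polarVec {w : ℝ} (hw : 0 < w) {q : ℝ × ℝ × ℝ} (hq : q.1 ∈ Ioo (0 : ℝ) 1) :
    ‖(polarVec w q).1‖ ^ 2 + ‖(polarVec w q).2‖ ^ 2 = w := by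
  rw [polarVec, norm_polar_sq (mul_nonneg hw.le hq.1.le),
    norm_polar_sq (mul_nonneg hw.le (by linarith [hq.2]))]
  ring

theorem measurable_exp_sphereForm_coeff (φ : Fin 2 → Fin 2 → ℝ) (w : ℝ) :
    Measurable fun p : (ℝ × ℝ × ℝ) × ℂ × ℝ × ℝ =>
      Real.exp (sphereForm (diagCoeff φ w p.2.1 (√p.2.2.1 * cexp (p.2.2.2 * I)))
        (offDiagCoeff φ w p.2.1 (√p.2.2.1 * cexp (p.2.2.2 * I))) (polarVec w p.1)) := by
  unfold sphereForm diagCoeff offDiagCoeff polarVec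
  fun_prop

theorem gramDensity_hermitianOf (φ : Fin 2 → Fin 2 → ℝ) (w y : ℝ) (z : ℂ) :
    gramDensity φ (hermitianOf (w, y, z)) =
      Real.pi ^ 3 * radialFactor φ w y * sinhc (1 / 2 * √(D φ (hermitianOf (w, y, z)))) := by
  have := Real.pi_pos
  simp only [gramDensity, radialFactor]
  congr 1
  simp only [hermitianOf, Matrix.of_apply, Matrix.cons_val', Matrix.cons_val_zero,
    Matrix.cons_val_one, Matrix.cons_val_fin_one, ofReal_re]
  field_simp

theorem measurable_hermitianOf : Measurable hermitianOf := by
  refine measurable_pi_iff.2 fun i => measurable_pi_iff.2 fun j => ?_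
  fin_cases i <;> fin_cases j <;> simp [hermitianOf] <;> fun_prop

/-- The integral over the direction of the first row, in terms of the entries of the Gram matrix
`hermitianOf (w, y, z)` with `‖z‖ ^ 2 + x = w * y`. -/
theorem lintegral_direction (φ : Fin 2 → Fin 2 → ℝ) {w : ℝ} (hw : 0 < w) (z : ℂ) {x : ℝ}
    (hx : 0 < x) (θ : ℝ) :
    ∫⁻ q, ENNReal.ofReal (Real.exp (sphereForm (diagCoeff φ w z (√x * cexp (θ * I)))
        (offDiagCoeff φ w z (√x * cexp (θ * I))) (polarVec w q))) ∂directionMeasure =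
      ENNReal.ofReal ((2 * Real.pi) ^ 2 *
        sinhc (1 / 2 * √(D φ (hermitianOf (w, (‖z‖ ^ 2 + x) / w, z))))) := by
  have hm := measurable_sphereForm (diagCoeff φ w z (√x * cexp (θ * I)))
        (offDiagCoeff φ w z (√x * cexp (θ * I)))
  have hp := measurable_polarVec w
  rw [lintegral_directionMeasure _ (by fun_prop)]
  simp only [polarVec]
  rw [lintegral_sphere_exp_sphereForm _ _ hw, sqrt_coeff_eq φ hw, norm_polar_sq hx.le]

theorem setLIntegral_Ioi_eq_shift {w : ℝ} (hw : 0 < w) (r : ℝ) (g : ℝ → ENNReal) :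
    ∫⁻ x in Ioi (0 : ℝ), g x = ∫⁻ y in Ioi (r / w), ENNReal.ofReal w * g (w * y - r) := by
  have himg : (fun y => w * y + -r) '' Ioi (r / w) = Ioi 0 := by
    ext x
    constructor
    · rintro ⟨y, hy, rfl⟩
      have : r < y * w := (div_lt_iff₀ hw).1 hy
      simp only [mem_Ioi]
      linarith
    · intro hx
      refine ⟨(x + r) / w, ?_, by field_simp; ring⟩
      exact (div_lt_div_iff_of_pos_right hw).2 (by linarith [mem_Ioi.1 hx])
  rw [← himg, setLIntegral_image_affine _ hw _ measurableSet_Ioi]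
  rfl

/-- The joint density times `f` of the Gram matrix, in the coordinates `q` (direction of the first
row) and `k` (second row) for a fixed squared norm `w` of the first row. The Jacobian `1 / (8 w)`
is the product of `w / 4` from the first row and `1 / (2 w²)` from the second. -/
noncomputable def fibreIntegrand (φ : Fin 2 → Fin 2 → ℝ) (f : ℝ × ℝ × ℂ → ENNReal) (w : ℝ)
    (q : ℝ × ℝ × ℝ) (k : ℂ × ℝ × ℝ) : ENNReal :=
  ENNReal.ofReal (1 / (8 * w)) *
    (ENNReal.ofReal (radialFactor φ w ((‖k.1‖ ^ 2 + k.2.1) / w)) *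
      ENNReal.ofReal (Real.exp (sphereForm (diagCoeff φ w k.1 (√k.2.1 * cexp (k.2.2 * I)))
        (offDiagCoeff φ w k.1 (√k.2.1 * cexp (k.2.2 * I))) (polarVec w q))) *
      f (w, (‖k.1‖ ^ 2 + k.2.1) / w, k.1))

theorem measurable_fibreIntegrand (φ : Fin 2 → Fin 2 → ℝ) (f : ℝ × ℝ × ℂ → ENNReal)
    (hf : Measurable f) (w : ℝ) : Measurable (Function.uncurry (fibreIntegrand φ f w)) := by
  have hrad : Measurable fun p : (ℝ × ℝ × ℝ) × ℂ × ℝ × ℝ =>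
      radialFactor φ w ((‖p.2.1‖ ^ 2 + p.2.2.1) / w) := by
    unfold radialFactor
    fun_prop
  exact (hrad.ennreal_ofReal.mul (measurable_exp_sphereForm_coeff φ w).ennreal_ofReal).mul
    (by fun_prop) |>.const_mul _

/-- Integrating out the direction of the first row and the phase of the orthogonal component of
the second produces the density of the Gram matrix. -/
theorem lintegral_fibreIntegrand (φ : Fin 2 → Fin 2 → ℝ) (hφ : ∀ i j, 0 < φ i j)
    (f : ℝ × ℝ × ℂ → ENNReal) (hf : Measurable f) {w : ℝ} (hw : 0 < w) :
    ∫⁻ k, ∫⁻ q, fibreIntegrand φ f w q k ∂directionMeasure ∂secondRowMeasure =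
      ∫⁻ z : ℂ, ∫⁻ y in Ioi (‖z‖ ^ 2 / w),
        ENNReal.ofReal (gramDensity φ (hermitianOf (w, y, z))) * f (w, y, z) := by
  rw [lintegral_secondRowMeasure]
  · refine lintegral_congr fun z => ?_
    rw [setLIntegral_Ioi_eq_shift hw (‖z‖ ^ 2)]
    refine setLIntegral_congr_fun measurableSet_Ioi fun y hy => ?_
    have hx : 0 < w * y - ‖z‖ ^ 2 := by
      have := (div_lt_iff₀ hw).1 hy
      linarith
    have hy' : (‖z‖ ^ 2 + (w * y - ‖z‖ ^ 2)) / w = y := by field_simp; ring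
    have hin : ∀ θ : ℝ, ∫⁻ q, ENNReal.ofReal (1 / (8 * w)) *
        (ENNReal.ofReal (radialFactor φ w y) * ENNReal.ofReal (Real.exp (sphereForm
          (diagCoeff φ w z (√(w * y - ‖z‖ ^ 2) * cexp (θ * I)))
          (offDiagCoeff φ w z (√(w * y - ‖z‖ ^ 2) * cexp (θ * I))) (polarVec w q))) *
          f (w, y, z)) ∂directionMeasure =
        ENNReal.ofReal (1 / (8 * w)) * (ENNReal.ofReal (radialFactor φ w y) *
          ENNReal.ofReal ((2 * Real.pi) ^ 2 *
            sinhc (1 / 2 * √(D φ (hermitianOf (w, y, z))))) * f (w, y, z)) := by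
      intro θ
      have hm := measurable_sphereForm (diagCoeff φ w z (√(w * y - ‖z‖ ^ 2) * cexp (θ * I)))
        (offDiagCoeff φ w z (√(w * y - ‖z‖ ^ 2) * cexp (θ * I)))
      have hp := measurable_polarVec w
      rw [lintegral_const_mul _ (by fun_prop), lintegral_mul_const _ (by fun_prop),
        lintegral_const_mul _ (by fun_prop), lintegral_direction φ hw z hx θ, hy']
    have hs := sinhc_nonneg (1 / 2 * √(D φ (hermitianOf (w, y, z))))
    have hr := radialFactor_nonneg hφ w y
    have hpi := Real.pi_pos
    simp only [fibreIntegrand, hy', hin, lintegral_const, Measure.restrict_apply_univ,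
      Real.volume_Ioo]
    rw [gramDensity_hermitianOf]
    have hcomb : ENNReal.ofReal (Real.pi ^ 3 * radialFactor φ w y *
        sinhc (1 / 2 * √(D φ (hermitianOf (w, y, z))))) =
        ENNReal.ofReal w * (ENNReal.ofReal (1 / (8 * w)) * (ENNReal.ofReal (radialFactor φ w y) *
          ENNReal.ofReal ((2 * Real.pi) ^ 2 *
            sinhc (1 / 2 * √(D φ (hermitianOf (w, y, z)))))) *
          ENNReal.ofReal (Real.pi - -Real.pi)) := by
      rw [← ENNReal.ofReal_mul hr, ← ENNReal.ofReal_mul (by positivity),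
        ← ENNReal.ofReal_mul (by positivity), ← ENNReal.ofReal_mul hw.le]
      congr 1
      field_simp
      ring
    rw [hcomb]
    ring
  · have h := (measurable_fibreIntegrand φ f hf w).comp
      (measurable_swap : Measurable (Prod.swap : (ℂ × ℝ × ℝ) × (ℝ × ℝ × ℝ) → _))
    exact h.lintegral_prod_right'

theorem measurable_entriesDensity (φ : Fin 2 → Fin 2 → ℝ) :
    Measurable fun p : (ℂ × ℂ) × ℂ × ℂ => entriesDensity φ p.1 p.2 := by
  unfold entriesDensity complexGaussianDensity
  fun_prop

/-- The diagonal entries and the upper right entry of the Gram matrix of the rows `p.1, p.2`. -/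
noncomputable def gramCoords (p : (ℂ × ℂ) × ℂ × ℂ) : ℝ × ℝ × ℂ :=
  (‖p.1.1‖ ^ 2 + ‖p.1.2‖ ^ 2, ‖p.2.1‖ ^ 2 + ‖p.2.2‖ ^ 2,
    p.1.1 * conj p.2.1 + p.1.2 * conj p.2.2)

theorem measurable_gramCoords : Measurable gramCoords := by
  unfold gramCoords
  fun_prop

theorem lintegral_second_row_entriesDensity (φ : Fin 2 → Fin 2 → ℝ) (hφ : ∀ i j, 0 < φ i j)
    (f : ℝ × ℝ × ℂ → ENNReal) (hf : Measurable f) {w : ℝ} (hw : 0 < w) {q : ℝ × ℝ × ℝ}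
    (hq : q.1 ∈ Ioo (0 : ℝ) 1) :
    ENNReal.ofReal (w / 4) * ∫⁻ r, ENNReal.ofReal (entriesDensity φ (polarVec w q) r) *
        f (gramCoords (polarVec w q, r)) =
      ∫⁻ k, fibreIntegrand φ f w q k ∂secondRowMeasure := by
  have hv := norm_sq_polarVec hw hq
  have hd := measurable_entriesDensity φ
  have hg := measurable_gramCoords
  have hd' : Measurable fun r => entriesDensity φ (polarVec w q) r :=
    Measurable.of_uncurry_left (f := entriesDensity φ) hd
  have hk : Measurable (fibreIntegrand φ f w q) :=
    (measurable_fibreIntegrand φ f hf w).of_uncurry_left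
  rw [lintegral_eq_secondRow hw hv _ (by fun_prop), ← mul_assoc,
    ← ENNReal.ofReal_mul (by positivity), show w / 4 * (1 / (2 * w ^ 2)) = 1 / (8 * w) by
      field_simp; norm_num,
    lintegral_secondRowMeasure _ hk]
  simp only [fibreIntegrand]
  set c := ENNReal.ofReal (1 / (8 * w)) with hc
  have hctop : c ≠ ⊤ := ENNReal.ofReal_ne_top
  rw [← lintegral_const_mul' _ _ hctop]
  refine lintegral_congr fun z => ?_
  rw [← lintegral_const_mul' _ _ hctop]
  refine setLIntegral_congr_fun measurableSet_Ioi fun x hx => ?_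
  have hx' : (0 : ℝ) < x := hx
  rw [← lintegral_const_mul' _ _ hctop]
  refine lintegral_congr fun θ => ?_
  rw [entriesDensity_secondRow φ hw hv, gramCoords, inner_secondRow hw hv,
    norm_sq_secondRow hw hv, hv, norm_polar_sq hx'.le,
    ENNReal.ofReal_mul (radialFactor_nonneg hφ w ((‖z‖ ^ 2 + x) / w))]

/-- The image of the joint density of the entries under the Gram map, tested against `f`. -/
theorem lintegral_entriesDensity_gramCoords (φ : Fin 2 → Fin 2 → ℝ) (hφ : ∀ i j, 0 < φ i j)
    (f : ℝ × ℝ × ℂ → ENNReal) (hf : Measurable f) :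
    ∫⁻ p : (ℂ × ℂ) × ℂ × ℂ, ENNReal.ofReal (entriesDensity φ p.1 p.2) * f (gramCoords p) =
      ∫⁻ w in Ioi (0 : ℝ), ∫⁻ z : ℂ, ∫⁻ y in Ioi (‖z‖ ^ 2 / w),
        ENNReal.ofReal (gramDensity φ (hermitianOf (w, y, z))) * f (w, y, z) := by
  have hd := measurable_entriesDensity φ
  have hg := measurable_gramCoords
  have hm : Measurable fun p : (ℂ × ℂ) × ℂ × ℂ =>
      ENNReal.ofReal (entriesDensity φ p.1 p.2) * f (gramCoords p) := by fun_prop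
  rw [Measure.volume_eq_prod, lintegral_prod _ hm.aemeasurable,
    lintegral_complex_prod_eq_polar _ hm.lintegral_prod_right']
  refine setLIntegral_congr_fun measurableSet_Ioi fun w hw => ?_
  have hf' := measurable_fibreIntegrand φ f hf w
  rw [← lintegral_fibreIntegrand φ hφ f hf hw, ← lintegral_lintegral_swap hf'.aemeasurable,
    lintegral_directionMeasure (fun q => ∫⁻ k, fibreIntegrand φ f w q k ∂secondRowMeasure)
      hf'.lintegral_prod_right']
  refine setLIntegral_congr_fun measurableSet_Ioo fun t ht => ?_
  refine lintegral_congr fun α => lintegral_congr fun β => ?_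
  exact lintegral_second_row_entriesDensity φ hφ f hf hw (q := (t, α, β)) ht

/-! ### The law of the entries -/

theorem complexGaussian_eq_withDensity {v : ℝ} (hv : 0 < v) :
    complexGaussian v = (volume : Measure ℂ).withDensity
      fun z => ENNReal.ofReal (complexGaussianDensity v z) := by
  have hv2 : (v / 2).toNNReal ≠ 0 := by simpa using hv
  have hval : ((v / 2).toNNReal : ℝ) = v / 2 := Real.coe_toNNReal _ (by positivity)
  have hpdf : ∀ z : ℂ, gaussianPDF 0 (v / 2).toNNReal z.re * gaussianPDF 0 (v / 2).toNNReal z.im =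
      ENNReal.ofReal (complexGaussianDensity v z) := by
    intro z
    rw [gaussianPDF, gaussianPDF, ← ENNReal.ofReal_mul (gaussianPDFReal_nonneg _ _ _)]
    congr 1
    simp only [gaussianPDFReal, complexGaussianDensity, hval, sub_zero]
    rw [mul_mul_mul_comm, ← Real.exp_add, ← mul_inv, Real.mul_self_sqrt (by positivity),
      ← normSq_eq_norm_sq, normSq_apply]
    congr 1
    · field_simp
    · congr 1
      field_simp
      ring
  have hm := measurable_complexGaussianDensity v
  have hmp := volume_preserving_equiv_real_prod
  rw [complexGaussian, gaussianReal_of_var_ne_zero _ hv2,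
    prod_withDensity (measurable_gaussianPDF _ _) (measurable_gaussianPDF _ _),
    ← Measure.volume_eq_prod]
  have hpm : Measurable fun p : ℝ × ℝ =>
      gaussianPDF 0 (v / 2).toNNReal p.1 * gaussianPDF 0 (v / 2).toNNReal p.2 :=
    ((measurable_gaussianPDF _ _).comp measurable_fst).mul
      ((measurable_gaussianPDF _ _).comp measurable_snd)
  refine Measure.ext_of_lintegral _ fun g hg => ?_
  rw [lintegral_map hg (MeasurableEquiv.measurable _),
    lintegral_withDensity_eq_lintegral_mul _ hpm (by fun_prop),
    lintegral_withDensity_eq_lintegral_mul _ (by fun_prop) hg,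
    ← hmp.lintegral_comp (by fun_prop)]
  refine lintegral_congr fun z => ?_
  simp only [Pi.mul_apply, MeasurableEquiv.symm_apply_apply]
  rw [← hpdf]
  rfl

theorem map_entries {Ω : Type*} [MeasurableSpace Ω] (P : Measure Ω) [IsProbabilityMeasure P]
    (φ : Fin 2 → Fin 2 → ℝ) (hφ : ∀ i j, 0 < φ i j)
    (H : Ω → Matrix (Fin 2) (Fin 2) ℂ)
    (hlaw : ∀ i j, HasLaw (fun ω => H ω i j) (complexGaussian (φ i j)) P)
    (hindep : iIndepFun (fun (p : Fin 2 × Fin 2) (ω : Ω) => H ω p.1 p.2) P) :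
    P.map (fun ω => ((H ω 0 0, H ω 0 1), (H ω 1 0, H ω 1 1))) =
      (volume : Measure ((ℂ × ℂ) × ℂ × ℂ)).withDensity
        fun p => ENNReal.ofReal (entriesDensity φ p.1 p.2) := by
  have hae : ∀ p : Fin 2 × Fin 2, AEMeasurable (fun ω => H ω p.1 p.2) P := fun p =>
    (hlaw p.1 p.2).aemeasurable
  have hm := fun i j => (measurable_complexGaussianDensity (φ i j)).ennreal_ofReal
  have hrow : ∀ i, P.map (fun ω => (H ω i 0, H ω i 1)) =
      (volume : Measure (ℂ × ℂ)).withDensity fun p =>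
        ENNReal.ofReal (complexGaussianDensity (φ i 0) p.1) *
          ENNReal.ofReal (complexGaussianDensity (φ i 1) p.2) := by
    intro i
    have h := hindep.indepFun (i := (i, 0)) (j := (i, 1)) (by simp)
    rw [(indepFun_iff_map_prod_eq_prod_map_map (hae (i, 0)) (hae (i, 1))).1 h,
      (hlaw i 0).map_eq, (hlaw i 1).map_eq, complexGaussian_eq_withDensity (hφ _ _),
      complexGaussian_eq_withDensity (hφ _ _), prod_withDensity (hm _ _) (hm _ _),
      ← Measure.volume_eq_prod]
  have h := hindep.indepFun_prodMk_prodMk₀ hae (0, 0) (0, 1) (1, 0) (1, 1)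
    (by simp) (by simp) (by simp) (by simp)
  have hm2 : ∀ i, Measurable fun p : ℂ × ℂ =>
      ENNReal.ofReal (complexGaussianDensity (φ i 0) p.1) *
          ENNReal.ofReal (complexGaussianDensity (φ i 1) p.2) := fun i =>
    ((hm i 0).comp measurable_fst).mul ((hm i 1).comp measurable_snd)
  rw [(indepFun_iff_map_prod_eq_prod_map_map ((hae (0, 0)).prodMk (hae (0, 1)))
    ((hae (1, 0)).prodMk (hae (1, 1)))).1 h, hrow, hrow, prod_withDensity (hm2 0) (hm2 1),
    ← Measure.volume_eq_prod]
  congr 1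
  funext p
  have hn := fun i j z => complexGaussianDensity_nonneg (hφ i j) z
  rw [entriesDensity, ENNReal.ofReal_mul (mul_nonneg (hn _ _ _) (hn _ _ _)),
    ENNReal.ofReal_mul (hn _ _ _), ENNReal.ofReal_mul (hn _ _ _)]

theorem mul_conjTranspose_eq_hermitianOf (W : Matrix (Fin 2) (Fin 2) ℂ) :
    W * Wᴴ = hermitianOf (gramCoords ((W 0 0, W 0 1), (W 1 0, W 1 1))) := by
  ext i j
  fin_cases i <;> fin_cases j <;>
    simp [hermitianOf, gramCoords, Matrix.mul_apply, Fin.sum_univ_two, mul_conj', mul_comm]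

/-! ### Positive semidefinite `2 × 2` matrices -/

theorem posSemidef_hermitianOf_iff (w y : ℝ) (z : ℂ) :
    (hermitianOf (w, y, z)).PosSemidef ↔ 0 ≤ w ∧ 0 ≤ y ∧ ‖z‖ ^ 2 ≤ w * y := by
  constructor
  · intro h
    have h0 := h.diag_nonneg (i := 0)
    have h1 := h.diag_nonneg (i := 1)
    have hd := h.det_nonneg
    simp only [hermitianOf, Matrix.of_apply, Matrix.cons_val', Matrix.cons_val_zero,
      Matrix.cons_val_one, Matrix.cons_val_fin_one, Matrix.det_fin_two_of] at h0 h1 hd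
    refine ⟨by exact_mod_cast h0, by exact_mod_cast h1, ?_⟩
    rw [← starRingEnd_apply, mul_conj'] at hd
    have : (0 : ℝ) ≤ w * y - ‖z‖ ^ 2 := by exact_mod_cast hd
    linarith
  · rintro ⟨hw, hy, hz⟩
    rw [Matrix.posSemidef_iff_dotProduct_mulVec]
    refine ⟨?_, fun x => ?_⟩
    · ext i j
      fin_cases i <;> fin_cases j <;> simp [hermitianOf]
    · have heq : star x ⬝ᵥ (hermitianOf (w, y, z)).mulVec x =
          ((w * ‖x 0‖ ^ 2 + y * ‖x 1‖ ^ 2 + 2 * (conj (x 0) * z * x 1).re : ℝ) : ℂ) := by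
        rw [ofReal_add, show ∀ a : ℂ, ((2 * a.re : ℝ) : ℂ) = a + conj a from
          fun a => (add_conj a).symm]
        push_cast
        simp only [dotProduct, Matrix.mulVec, Fin.sum_univ_two, hermitianOf, Pi.star_apply,
          Matrix.of_apply, Matrix.cons_val', Matrix.cons_val_zero,
          Matrix.cons_val_one, Matrix.cons_val_fin_one, ← mul_conj', map_mul, conj_conj,
          ← starRingEnd_apply]
        ring
      rw [heq]
      refine zero_le_real.2 ?_
      rcases hw.eq_or_lt with rfl | hw
      · have hz0 : z = 0 := by
          have : ‖z‖ ^ 2 = 0 := le_antisymm (by simpa using hz) (by positivity)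
          simpa using this
        simp only [hz0, mul_zero, zero_mul, zero_re, add_zero, zero_add]
        positivity
      · -- Complete the square in the first coordinate.
        have hsq : w * (w * ‖x 0‖ ^ 2 + y * ‖x 1‖ ^ 2 + 2 * (conj (x 0) * z * x 1).re) =
            ‖w * x 0 + z * x 1‖ ^ 2 + (w * y - ‖z‖ ^ 2) * ‖x 1‖ ^ 2 := by
          simp only [← normSq_eq_norm_sq, normSq_apply, add_re, add_im, mul_re, mul_im, conj_re,
            conj_im, ofReal_re, ofReal_im]
          ring
        refine nonneg_of_mul_nonneg_right (a := w) ?_ hw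
        rw [hsq]
        have : 0 ≤ w * y - ‖z‖ ^ 2 := sub_nonneg.2 hz
        positivity

theorem eq_hermitianOf_of_isHermitian {W : Matrix (Fin 2) (Fin 2) ℂ} (hW : W.IsHermitian) :
    W = hermitianOf ((W 0 0).re, (W 1 1).re, W 0 1) := by
  have h0 := conj_eq_iff_re.1 (hW.apply 0 0)
  have h1 := conj_eq_iff_re.1 (hW.apply 1 1)
  ext i j
  fin_cases i <;> fin_cases j
  · exact h0.symm
  · rfl
  · exact (hW.apply 1 0).symm
  · exact h1.symm

theorem D_nonneg_of_posSemidef (φ : Fin 2 → Fin 2 → ℝ) {W : Matrix (Fin 2) (Fin 2) ℂ}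
    (hW : W.PosSemidef) : 0 ≤ D φ W := by
  have h := hW
  rw [eq_hermitianOf_of_isHermitian hW.1, posSemidef_hermitianOf_iff] at h
  obtain ⟨h0, h1, h2⟩ := h
  unfold D
  rcases le_total 0 (ε φ 0 * ε φ 1) with he | he
  · have : 0 ≤ 4 * ‖W 0 1‖ ^ 2 * (ε φ 0 * ε φ 1) := by positivity
    nlinarith [sq_nonneg ((W 0 0).re * ε φ 0 - (W 1 1).re * ε φ 1)]
  · nlinarith [sq_nonneg ((W 0 0).re * ε φ 0 + (W 1 1).re * ε φ 1),
      mul_le_mul_of_nonpos_right h2 he]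

theorem measurable_matrix_entry (i j : Fin 2) :
    Measurable fun W : Matrix (Fin 2) (Fin 2) ℂ => W i j :=
  (measurable_pi_apply j).comp (measurable_pi_apply (X := fun _ => Fin 2 → ℂ) i)

theorem measurableSet_posSemidef :
    MeasurableSet {W : Matrix (Fin 2) (Fin 2) ℂ | W.PosSemidef} := by
  have hm := measurable_matrix_entry
  have heq : {W : Matrix (Fin 2) (Fin 2) ℂ | W.PosSemidef} =
      {W | ∀ i j, conj (W j i) = W i j} ∩ ({W | 0 ≤ (W 0 0).re} ∩ ({W | 0 ≤ (W 1 1).re} ∩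
        {W | ‖W 0 1‖ ^ 2 ≤ (W 0 0).re * (W 1 1).re})) := by
    ext W
    by_cases hW : W.IsHermitian
    · have h : ∀ i j, conj (W j i) = W i j := hW.apply
      have h' := posSemidef_hermitianOf_iff (W 0 0).re (W 1 1).re (W 0 1)
      rw [← eq_hermitianOf_of_isHermitian hW] at h'
      simp only [mem_ofPred_eq, mem_inter_iff, h', h, implies_true, true_and]
    · constructor
      · exact fun h => (hW h.1).elim
      · exact fun h => (hW (Matrix.IsHermitian.ext h.1)).elim
  rw [heq]
  refine MeasurableSet.inter ?_ (.inter ?_ (.inter ?_ ?_))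
  · simp only [ofPred_forall]
    exact .iInter fun i => .iInter fun j => measurableSet_eq_fun
      (continuous_conj.measurable.comp (hm j i)) (hm i j)
  · exact measurableSet_le measurable_const (measurable_re.comp (hm 0 0))
  · exact measurableSet_le measurable_const (measurable_re.comp (hm 1 1))
  · exact measurableSet_le ((hm 0 1).norm.pow_const 2)
      ((measurable_re.comp (hm 0 0)).mul (measurable_re.comp (hm 1 1)))

theorem measurable_gramDensity (φ : Fin 2 → Fin 2 → ℝ) : Measurable (gramDensity φ) := by
  have hre := fun i j => measurable_re.comp (measurable_matrix_entry i j)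
  have hn := (measurable_matrix_entry 0 1).norm
  have hD : Measurable (D φ) :=
    ((((hre 0 0).mul_const _).sub ((hre 1 1).mul_const _)).pow_const 2).add
      ((((hn.pow_const 2).const_mul 4).mul_const _).mul_const _)
  have hexp := ((((hre 0 0).mul_const (s φ 0)).add ((hre 1 1).mul_const (s φ 1))).const_mul
    (-(1 / 2))).exp
  exact (hexp.const_mul _).mul (measurable_sinhc.comp (hD.sqrt.const_mul (1 / 2)))

theorem lintegral_indicator_posSemidef (F : ℝ × ℝ × ℂ → ENNReal) (hF : Measurable F) :
    ∫⁻ x, {x | (hermitianOf x).PosSemidef}.indicator F x =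
      ∫⁻ w in Ioi (0 : ℝ), ∫⁻ z : ℂ, ∫⁻ y in Ioi (‖z‖ ^ 2 / w), F (w, y, z) := by
  have hS : MeasurableSet {x | (hermitianOf x).PosSemidef} :=
    measurableSet_posSemidef.preimage measurable_hermitianOf
  have hm : Measurable ({x | (hermitianOf x).PosSemidef}.indicator F) := hF.indicator hS
  rw [Measure.volume_eq_prod, lintegral_prod _ hm.aemeasurable,
    ← lintegral_indicator measurableSet_Ioi]
  -- The boundary cases `w = 0` and `‖z‖ ^ 2 = w * y` form a null set.
  have h0 : ∀ᵐ w : ℝ, w ≠ 0 := by simp [ae_iff]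
  refine lintegral_congr_ae (h0.mono fun w hw0 => ?_)
  simp only
  rcases lt_or_gt_of_ne hw0 with hw | hw
  · rw [indicator_of_notMem (by simpa using hw.le)]
    refine (lintegral_congr fun p => ?_).trans lintegral_zero
    refine indicator_of_notMem (fun h => ?_) _
    exact hw.not_ge ((posSemidef_hermitianOf_iff _ _ _).1 h).1
  · have hmw : Measurable fun p : ℝ × ℂ =>
        {x | (hermitianOf x).PosSemidef}.indicator F (w, p) := hm.comp measurable_prodMk_left
    rw [indicator_of_mem (mem_Ioi.2 hw), Measure.volume_eq_prod,
      lintegral_prod_symm _ hmw.aemeasurable]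
    refine lintegral_congr fun z => ?_
    rw [setLIntegral_congr Ioi_ae_eq_Ici, ← lintegral_indicator measurableSet_Ici]
    refine lintegral_congr fun y => ?_
    have hiff : (w, y, z) ∈ {x | (hermitianOf x).PosSemidef} ↔ y ∈ Ici (‖z‖ ^ 2 / w) := by
      rw [mem_ofPred_eq, posSemidef_hermitianOf_iff, mem_Ici, div_le_iff₀' hw]
      refine ⟨fun h => h.2.2, fun h => ⟨hw.le, ?_, h⟩⟩
      exact nonneg_of_mul_nonneg_right (le_trans (by positivity) h) hw
    by_cases hy : y ∈ Ici (‖z‖ ^ 2 / w)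
    · rw [indicator_of_mem hy, indicator_of_mem (hiff.2 hy)]
    · rw [indicator_of_notMem hy, indicator_of_notMem (mt hiff.1 hy)]

theorem hasLaw_mul_conjTranspose {Ω : Type*} [MeasurableSpace Ω] (P : Measure Ω)
    [IsProbabilityMeasure P] (φ : Fin 2 → Fin 2 → ℝ) (hφ : ∀ i j, 0 < φ i j)
    (H : Ω → Matrix (Fin 2) (Fin 2) ℂ)
    (hlaw : ∀ i j, HasLaw (fun ω => H ω i j) (complexGaussian (φ i j)) P)
    (hindep : iIndepFun (fun (p : Fin 2 × Fin 2) (ω : Ω) => H ω p.1 p.2) P) :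
    HasLaw (fun ω => H ω * (H ω)ᴴ)
      ((hermitianLebesgue.restrict {W | W.PosSemidef}).withDensity
        (fun W => ENNReal.ofReal (gramDensity φ W))) P := by
  have hae : ∀ i j, AEMeasurable (fun ω => H ω i j) P := fun i j => (hlaw i j).aemeasurable
  have hent : AEMeasurable (fun ω => ((H ω 0 0, H ω 0 1), (H ω 1 0, H ω 1 1))) P :=
    ((hae 0 0).prodMk (hae 0 1)).prodMk ((hae 1 0).prodMk (hae 1 1))
  have hmeas : Measurable (hermitianOf ∘ gramCoords) :=
    measurable_hermitianOf.comp measurable_gramCoords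
  simp only [mul_conjTranspose_eq_hermitianOf]
  refine ⟨hmeas.comp_aemeasurable hent, ?_⟩
  refine Measure.ext_of_lintegral _ fun g hg => ?_
  have hp := (measurable_gramDensity φ).ennreal_ofReal
  have hfm := hg.comp measurable_hermitianOf
  have hmap := AEMeasurable.map_map_of_aemeasurable hmeas.aemeasurable hent
  simp only [Function.comp_def] at hmap hmeas
  have hgm : Measurable fun p => g (hermitianOf (gramCoords p)) := hg.comp hmeas
  rw [← hmap, map_entries P φ hφ H hlaw hindep, lintegral_map hg hmeas,
    lintegral_withDensity_eq_lintegral_mul _ (measurable_entriesDensity φ).ennreal_ofReal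
      hgm,
    lintegral_withDensity_eq_lintegral_mul _ hp hg,
    ← lintegral_indicator measurableSet_posSemidef, hermitianLebesgue,
    lintegral_map ((hp.mul hg).indicator measurableSet_posSemidef) measurable_hermitianOf]
  refine (lintegral_entriesDensity_gramCoords φ hφ _ hfm).trans ?_
  exact (lintegral_indicator_posSemidef _ ((hp.mul hg).comp measurable_hermitianOf)).symm

end GramGaussian

theorem theorem1 {Ω : Type*} [MeasurableSpace Ω] (P : Measure Ω) [IsProbabilityMeasure P]
    (φ : Fin 2 → Fin 2 → ℝ) (hφ : ∀ i j, 0 < φ i j) (hne : ∃ i, φ i 0 ≠ φ i 1)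
    (H : Ω → Matrix (Fin 2) (Fin 2) ℂ)
    (hlaw : ∀ i j, HasLaw (fun ω => H ω i j) (GramGaussian.complexGaussian (φ i j)) P)
    (hindep : iIndepFun (fun (p : Fin 2 × Fin 2) (ω : Ω) => H ω p.1 p.2) P) :
    (∀ W : Matrix (Fin 2) (Fin 2) ℂ, W.PosSemidef → 0 ≤ GramGaussian.D φ W) ∧
    HasLaw (fun ω => H ω * (H ω)ᴴ)
      ((GramGaussian.hermitianLebesgue.restrict {W | W.PosSemidef}).withDensity
        (fun W => ENNReal.ofReal (GramGaussian.gramDensity φ W))) P :=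
  ⟨fun _ hW => GramGaussian.D_nonneg_of_posSemidef φ hW,
    GramGaussian.hasLaw_mul_conjTranspose P φ hφ H hlaw hindep⟩
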